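/- All automata are over a finite input alphabet $\Sigma$. For a finite set $Q$, let $\mathcal H_Q$ be the Hilbert space with orthonormal basis $\{|q\rangle : q\in Q\}$. A projective measurement on $\mathcal H_Q$ with finite outcome set $C$ is a family $\{P_c\}_{c\in C}$ of Hermitian projectors with $\sum_c P_c=I$; a general measurement is a family $\{M^c\}_{c\in C}$ of operators with $\sum_c (M^c)^\dagger M^c=I$. A semi-quantum automaton $\mathcal A$ with $q$ quantum basis states and $k$ classical states is one of the following, accepting $x=x_1\cdots x_n\in\Sigma^*$ with probability $\mathcal P_{\mathcal A}(x)$. - CL-1QFA: a finite set $Q$ with $|Q|=q$, an initial $q_1\in Q$, unitaries $U_\sigma$ ($\sigma\in\Sigma$), a projective measurement $\{P_c\}_{c\in C}$, and a regular control language $\mathcal L\subseteq C^*$ whose minimal DFA has $k$ states; $$\mathcal P_{\mathcal A}(x)=\sum_{y_1\cdots y_n\in\mathcal L}\|P_{y_n}U_{x_n}\cdots P_{y_1}U_{x_1}|q_1\rangle\|^2 .$$ - 1QFAC: finite sets $Q,S$ with $|Q|=q$, $|S|=k$, initial $q_1\in Q$ and $s_1\in S$, unitaries $U_{s,\sigma}$,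 a transition function $\tau:S\times\Sigma\to S$, and for each $s\in S$ a projective measurement $\{P_{s,a},P_{s,r}\}$; $$\mathcal P_{\mathcal A}(x)=\|P_{s_{n+1},a}U_{s_n,x_n}\cdots U_{s_1,x_1}|q_1\rangle\|^2,\qquad s_{i+1}=\tau(s_i,x_i).$$ - 1QCFA: finite sets $Q,S,C$ with $|Q|=q$, $|S|=k$, initial $q_1\in Q$ and $s_1\in S$, for each $(s,\sigma)\in S\times\Sigma$ a general measurement $\{M^c_{s,\sigma}\}_{c\in C}$ on $\mathcal H_Q$, a transition function $\tau:S\times\Sigma\times C\to S$, and a set $S_a\subseteq S$ of accepting states; $$\mathcal P_{\mathcal A}(x)=\sum_{c_1\cdots c_n\in C^n:\ s_{n+1}\in S_a}\|M^{c_n}_{s_n,x_n}\cdots M^{c_1}_{s_1,x_1}|q_1\rangle\|^2,\qquad s_{i+1}=\tau(s_i,x_i,c_i).$$ A language $L\subseteq\Sigma^*$ is recognized by $\mathcal A$ with cut-point isolated by $\delta$, where $\delta\in(0,\tfrac12]$, if for some $\lambda\in(0,1]$ we have $\mathcal P_{\mathcal A}(x)>\lambda$ for all $x\in L$, $\mathcal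 P_{\mathcal A}(x)\le\lambda$ for all $x\in\Sigma^*\setminus L$, and $|\mathcal P_{\mathcal A}(x)-\lambda|\ge\delta$ for all $x\in\Sigma^*$. Theorem. Suppose that a semi-quantum automaton (a CL-1QFA, a 1QFAC or a 1QCFA) with $q$ quantum basis states and $k$ classical states recognizes, with cut-point isolated by $\delta$, a regular language whose minimal (complete) DFA has $d$ states. Then $$qk\ \ge\ \left[\frac{\log d}{2\log\frac{2}{\delta}}\right]^{4/9}.$$ -/

import Mathlib

open scoped Matrix

namespace SemiQuantum

/-- `L` is a regular language whose minimal (complete, deterministic) finite automaton has exactly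
`d` states. -/
def HasMinimalDFASize {α : Type*} (L : Language α) (d : ℕ) : Prop :=
  IsLeast {n : ℕ | ∃ M : DFA α (Fin n), M.accepts = L} d

/-- The basis vector `|q⟩` of the Hilbert space spanned by `Q`. -/
def ket {Q : Type*} [DecidableEq Q] (q : Q) : Q → ℂ := Pi.single q 1

/-- The squared Euclidean norm `‖v‖²` of a vector of the Hilbert space spanned by `Q`. -/
noncomputable def normSq {Q : Type*} [Fintype Q] (v : Q → ℂ) : ℝ :=
  ‖(WithLp.toLp 2 v : EuclideanSpace ℂ Q)‖ ^ 2

/-- A general measurement on the Hilbert space spanned by `Q`, with outcome set `C`. -/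
structure GeneralMeasurement (Q C : Type*) [Fintype Q] [DecidableEq Q] [Fintype C] where
  /-- The measurement operators. -/
  op : C → Matrix Q Q ℂ
  complete : ∑ c, (op c)ᴴ * op c = 1

/-- A projective measurement on the Hilbert space spanned by `Q`, with outcome set `C`: a family of
Hermitian idempotents that sum to the identity (and are therefore mutually orthogonal). -/
structure ProjectiveMeasurement (Q C : Type*) [Fintype Q] [DecidableEq Q] [Fintype C] where
  /-- The projectors. -/
  proj : C → Matrix Q Q ℂ
  isProj : ∀ c, IsStarProjection (proj c)
  complete : ∑ c, proj c = 1

/-- The language `L` is recognized, with cut-point isolated by `δ`, by an automaton that accepts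
each word `x` with probability `P x`. -/
def RecognizesIsolated {α : Type*} (P : List α → ℝ) (L : Language α) (δ : ℝ) : Prop :=
  δ ∈ Set.Ioc (0 : ℝ) (1 / 2) ∧
    ∃ cut ∈ Set.Ioc (0 : ℝ) 1,
      (∀ x ∈ L, cut < P x) ∧ (∀ x ∉ L, P x ≤ cut) ∧ ∀ x, δ ≤ |P x - cut|

/-! ### One-way quantum finite automata with control language (CL-1QFA) -/

/-- A CL-1QFA over the alphabet `α`, with quantum basis states `Q` and measurement outcomes `C`. -/
structure CL1QFA (α Q C : Type*) [Fintype Q] [DecidableEq Q] [Fintype C] where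
  /-- The initial quantum state. -/
  start : Q
  /-- The unitary operators. -/
  U : α → Matrix.unitaryGroup Q ℂ
  /-- The projective measurement. -/
  meas : ProjectiveMeasurement Q C
  /-- The control language. -/
  control : Language C
  control_regular : control.IsRegular

namespace CL1QFA

variable {α Q C : Type*} [Fintype Q] [DecidableEq Q] [Fintype C]

/-- The vector `P_{yₙ} U_{xₙ} ⋯ P_{y₁} U_{x₁} |q₁⟩`, for the list of the pairs `(xᵢ, yᵢ)`. -/
noncomputable def state (A : CL1QFA α Q C) (w : List (α × C)) : Q → ℂ :=
  w.foldl (fun v p => A.meas.proj p.2 *ᵥ ((A.U p.1 : Matrix Q Q ℂ) *ᵥ v)) (ket A.start)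

/-- The probability `p(y | x)` of the outcome sequence `y` on the input `x` (of the same length). -/
noncomputable def outcomeProb (A : CL1QFA α Q C) (x : List α) (y : List C) : ℝ :=
  normSq (A.state (x.zip y))

open Classical in
/-- The probability of accepting `x`. -/
noncomputable def acceptProb (A : CL1QFA α Q C) (x : List α) : ℝ :=
  ∑ y : Fin x.length → C,
    if List.ofFn y ∈ A.control then A.outcomeProb x (List.ofFn y) else 0

end CL1QFA

/-! ### One-way quantum finite automata together with classical states (1QFAC) -/

/-- A 1QFAC over the alphabet `α`, with quantum basis states `Q` and classical states `S`. -/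
structure QFAC (α Q S : Type*) [Fintype Q] [DecidableEq Q] where
  /-- The initial quantum state. -/
  start : Q
  /-- The initial classical state. -/
  cstart : S
  /-- The unitary operators. -/
  U : S → α → Matrix.unitaryGroup Q ℂ
  /-- The classical transition function. -/
  step : S → α → S
  /-- The final projective measurements; the outcome `true` is acceptance, `false` rejection. -/
  meas : S → ProjectiveMeasurement Q Bool

namespace QFAC

variable {α Q S : Type*} [Fintype Q] [DecidableEq Q]

/-- The classical state and the quantum state after reading a word. -/
noncomputable def run (A : QFAC α Q S) (x : List α) : S × (Q → ℂ) :=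
  x.foldl (fun p a => (A.step p.1 a, (A.U p.1 a : Matrix Q Q ℂ) *ᵥ p.2)) (A.cstart, ket A.start)

/-- The probability of accepting `x`. -/
noncomputable def acceptProb (A : QFAC α Q S) (x : List α) : ℝ :=
  normSq ((A.meas (A.run x).1).proj true *ᵥ (A.run x).2)

end QFAC

/-! ### One-way finite automata with quantum and classical states (1QCFA) -/

/-- A 1QCFA over the alphabet `α`, with quantum basis states `Q`, classical states `S` and
measurement outcomes `C`. -/
structure QCFA (α Q S C : Type*) [Fintype Q] [DecidableEq Q] [Fintype C] where
  /-- The initial quantum state. -/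
  start : Q
  /-- The initial classical state. -/
  cstart : S
  /-- The general measurements. -/
  meas : S → α → GeneralMeasurement Q C
  /-- The classical transition function. -/
  step : S → α → C → S
  /-- The accepting classical states. -/
  accept : Set S

namespace QCFA

variable {α Q S C : Type*} [Fintype Q] [DecidableEq Q] [Fintype C]

/-- The classical state and the (unnormalized) quantum state after reading the letters `xᵢ` with
outcomes `cᵢ`, for the list of the pairs `(xᵢ, cᵢ)`. -/
noncomputable def run (A : QCFA α Q S C) (w : List (α × C)) : S × (Q → ℂ) :=
  w.foldl (fun p e => (A.step p.1 e.1 e.2, (A.meas p.1 e.1).op e.2 *ᵥ p.2)) (A.cstart, ket A.start)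

open Classical in
/-- The probability of accepting `x`. -/
noncomputable def acceptProb (A : QCFA α Q S C) (x : List α) : ℝ :=
  ∑ c : Fin x.length → C,
    if (A.run (x.zip (List.ofFn c))).1 ∈ A.accept then
      normSq (A.run (x.zip (List.ofFn c))).2
    else 0

end QCFA

end SemiQuantum

/-!
A semi-quantum automaton acts linearly on families `S → Matrix Q Q ℂ` of unnormalized density
matrices, one for each classical state, and its acceptance probability is a linear functional of
such a family. So every automaton of the three kinds is a linear automaton on a real vector space of
dimension `2 * q ^ 2 * k`. Words with different left quotients by `L` are told apart by some suffix,
and isolation makes the two acceptance probabilities differ by at least `2 * δ`. Sending a word to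
its probabilities after finitely many suffixes thus gives `d` points of a sup-norm unit ball of
dimension at most `2 * q ^ 2 * k` at mutual distance at least `2 * δ`, and comparing volumes gives
`d ≤ (2 / δ) ^ (2 * q ^ 2 * k)`.
-/

namespace SemiQuantum

open MeasureTheory Module

section Packing

variable {ι : Type*} [Fintype ι] {R δ : ℝ}

theorem card_le_pow_finrank_of_separated {E : Type*} [NormedAddCommGroup E] [NormedSpace ℝ E]
    [FiniteDimensional ℝ E] (hR : 0 ≤ R) (hδ : 0 < δ) {v : ι → E} (hv : ∀ i, ‖v i‖ ≤ R)
    (hsep : Pairwise fun i j => 2 * δ ≤ ‖v i - v j‖) :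
    (Fintype.card ι : ℝ) ≤ (1 + R / δ) ^ finrank ℝ E := by
  borelize E
  let μ : Measure E := Measure.addHaar
  have hball (x : E) {r : ℝ} (hr : 0 < r) :
      μ.real (Metric.ball x r) = r ^ finrank ℝ E * μ.real (Metric.ball 0 1) := by
    rw [measureReal_def, μ.addHaar_ball_of_pos x hr, ENNReal.toReal_mul,
      ENNReal.toReal_ofReal (by positivity), measureReal_def]
  have hunit : 0 < μ.real (Metric.ball (0 : E) 1) :=
    ENNReal.toReal_pos (Metric.measure_ball_pos μ 0 one_pos).ne' measure_ball_lt_top.ne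
  have hdisj : Pairwise (Function.onFun Disjoint fun i => Metric.ball (v i) δ) := fun i j hij =>
    Metric.ball_disjoint_ball (by rw [dist_eq_norm]; linarith [hsep hij])
  have hsub : (⋃ i, Metric.ball (v i) δ) ⊆ Metric.ball 0 (R + δ) :=
    Set.iUnion_subset fun i =>
      Metric.ball_subset_ball' (by rw [dist_zero_right]; linarith [hv i])
  have hvol : Fintype.card ι * δ ^ finrank ℝ E * μ.real (Metric.ball (0 : E) 1) ≤
      (R + δ) ^ finrank ℝ E * μ.real (Metric.ball (0 : E) 1) :=
    calc
      _ = ∑ i, μ.real (Metric.ball (v i) δ) := by simp [hball _ hδ, mul_assoc]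
      _ = μ.real (⋃ i, Metric.ball (v i) δ) :=
        (measureReal_iUnion_fintype hdisj (fun _ => measurableSet_ball)
          fun _ => measure_ball_lt_top.ne).symm
      _ ≤ μ.real (Metric.ball (0 : E) (R + δ)) := measureReal_mono hsub measure_ball_lt_top.ne
      _ = _ := hball 0 (by positivity)
  rw [one_add_div hδ.ne', add_comm, div_pow, le_div_iff₀ (by positivity)]
  exact le_of_mul_le_mul_right hvol hunit

theorem card_le_pow_finrank_of_separated_dual {V J : Type*} [AddCommGroup V] [Module ℝ V]
    [FiniteDimensional ℝ V] (hR : 0 ≤ R) (hδ : 0 < δ) (f : J → Dual ℝ V) {v : ι → V}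
    (hv : ∀ i j, |f j (v i)| ≤ R)
    (hsep : Pairwise fun i i' => ∃ j, 2 * δ ≤ |f j (v i) - f j (v i')|) :
    (Fintype.card ι : ℝ) ≤ (1 + R / δ) ^ finrank ℝ V := by
  classical
  choose j hj using fun p : {p : ι × ι // p.1 ≠ p.2} => hsep p.2
  let Φ : V →ₗ[ℝ] ({p : ι × ι // p.1 ≠ p.2} → ℝ) := LinearMap.pi fun p => f (j p)
  calc
    (Fintype.card ι : ℝ) ≤ (1 + R / δ) ^ finrank ℝ (LinearMap.range Φ) :=
      card_le_pow_finrank_of_separated hR hδ (v := fun i => Φ.rangeRestrict (v i))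
        (fun i => (pi_norm_le_iff_of_nonneg hR).2 fun p => hv i (j p))
        fun i i' hne => (hj ⟨(i, i'), hne⟩).trans
          (norm_le_pi_norm (Φ (v i) - Φ (v i')) ⟨(i, i'), hne⟩)
    _ ≤ (1 + R / δ) ^ finrank ℝ V :=
      pow_le_pow_right₀ (le_add_of_nonneg_right (by positivity)) Φ.finrank_range_le

end Packing

section Languages

variable {α : Type*} {L : Language α} {d : ℕ}

theorem HasMinimalDFASize.exists_injective_leftQuotient (hL : HasMinimalDFASize L d) :
    ∃ x : Fin d → List α, Function.Injective fun i => L.leftQuotient (x i) := by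
  obtain ⟨⟨M, hM⟩, hmin⟩ := hL
  have hreg : L.IsRegular := ⟨Fin d, inferInstance, M, hM⟩
  have : Fintype (Set.range L.leftQuotient) := hreg.finite_range_leftQuotient.fintype
  have hd : d ≤ Fintype.card (Set.range L.leftQuotient) :=
    hmin ⟨DFA.reindex (Fintype.equivFin _) L.toDFA, by
      rw [DFA.accepts_reindex, Language.accepts_toDFA]⟩
  obtain ⟨f⟩ : Nonempty (Fin d ↪ Set.range L.leftQuotient) :=
    Function.Embedding.nonempty_of_card_le (by rwa [Fintype.card_fin])
  choose x hx using fun i => (f i).2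
  refine ⟨x, fun i j hij => f.injective (Subtype.ext ?_)⟩
  rw [← hx i, ← hx j]
  exact hij

theorem HasMinimalDFASize.pos (hL : HasMinimalDFASize L d) : 0 < d := by
  obtain ⟨⟨M, -⟩, -⟩ := hL
  exact M.start.pos

variable {P : List α → ℝ} {δ : ℝ}

theorem RecognizesIsolated.one_lt_two_div (hP : RecognizesIsolated P L δ) : 1 < 2 / δ := by
  obtain ⟨⟨hδ, hδ'⟩, -⟩ := hP
  rw [lt_div_iff₀ hδ]
  linarith

theorem RecognizesIsolated.two_mul_le_sub (hP : RecognizesIsolated P L δ) {x y : List α}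
    (hx : x ∈ L) (hy : y ∉ L) : 2 * δ ≤ P x - P y := by
  obtain ⟨-, cut, -, hacc, hrej, hiso⟩ := hP
  have hδx : δ ≤ P x - cut := (hiso x).trans_eq (abs_of_pos (sub_pos.2 (hacc x hx)))
  have hδy : δ ≤ -(P y - cut) := (hiso y).trans_eq (abs_of_nonpos (sub_nonpos.2 (hrej y hy)))
  linarith

theorem RecognizesIsolated.exists_two_mul_le_abs_sub (hP : RecognizesIsolated P L δ)
    {x y : List α} (hxy : L.leftQuotient x ≠ L.leftQuotient y) :
    ∃ w, 2 * δ ≤ |P (x ++ w) - P (y ++ w)| := by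
  obtain ⟨w, hw⟩ : ∃ w, ¬(x ++ w ∈ L ↔ y ++ w ∈ L) := by
    by_contra! h
    exact hxy (Set.ext h)
  refine ⟨w, ?_⟩
  by_cases hx : x ++ w ∈ L
  · exact (hP.two_mul_le_sub hx fun hy => hw (iff_of_true hx hy)).trans (le_abs_self _)
  · rw [abs_sub_comm]
    exact (hP.two_mul_le_sub (by tauto) hx).trans (le_abs_self _)

end Languages

/-- A linear (weighted) automaton over the alphabet `α` with states in the `R`-module `V`. It
assigns to each word an element of `R`, its weight: each letter acts on the state by a linear map,
and a functional reads off the weight at the end. -/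
structure LinearAutomaton (R α V : Type*) [CommSemiring R] [AddCommMonoid V] [Module R V] where
  start : V
  step : α → V →ₗ[R] V
  final : Dual R V

namespace LinearAutomaton

section Weight

variable {R α V : Type*} [CommSemiring R] [AddCommMonoid V] [Module R V]
  (A : LinearAutomaton R α V)

/-- The weight of a word read from a given vector, as a functional of this vector. -/
def weightFrom : List α → Dual R V
  | [] => A.final
  | a :: x => weightFrom x ∘ₗ A.step a

/-- The weight of a word read from the initial vector. -/
def weight (x : List α) : R := A.weightFrom x A.start

/-- The vector reached by reading a word from the initial vector. -/
def eval (x : List α) : V := x.foldl (fun v a => A.step a v) A.start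

theorem weightFrom_append (x w : List α) (v : V) :
    A.weightFrom (x ++ w) v = A.weightFrom w (x.foldl (fun v a => A.step a v) v) := by
  induction x generalizing v with
  | nil => rfl
  | cons a _ ih => exact ih (A.step a v)

theorem weightFrom_eval (x w : List α) : A.weightFrom w (A.eval x) = A.weight (x ++ w) :=
  (A.weightFrom_append x w A.start).symm

end Weight

variable {α V : Type*} [AddCommGroup V] [Module ℝ V] [FiniteDimensional ℝ V]
  (A : LinearAutomaton ℝ α V) {L : Language α} {d : ℕ} {δ : ℝ}

theorem natCast_le_pow_finrank (hA : ∀ x, |A.weight x| ≤ 1) (hL : HasMinimalDFASize L d)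
    (hP : RecognizesIsolated A.weight L δ) : (d : ℝ) ≤ (2 / δ) ^ finrank ℝ V := by
  obtain ⟨hδ, hδ'⟩ := hP.1
  obtain ⟨x, hx⟩ := hL.exists_injective_leftQuotient
  have hsep : Pairwise fun i j => ∃ w,
      2 * δ ≤ |A.weightFrom w (A.eval (x i)) - A.weightFrom w (A.eval (x j))| := by
    intro i j hij
    simpa only [weightFrom_eval] using hP.exists_two_mul_le_abs_sub (hx.ne hij)
  calc
    (d : ℝ) = Fintype.card (Fin d) := by rw [Fintype.card_fin]
    _ ≤ (1 + 1 / δ) ^ finrank ℝ V :=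
      card_le_pow_finrank_of_separated_dual zero_le_one hδ A.weightFrom
        (fun i w => by rw [weightFrom_eval]; exact hA _) hsep
    _ ≤ (2 / δ) ^ finrank ℝ V := by
      gcongr
      rw [one_add_div hδ.ne']
      gcongr
      linarith

theorem log_le_finrank_mul (hA : ∀ x, |A.weight x| ≤ 1) (hL : HasMinimalDFASize L d)
    (hP : RecognizesIsolated A.weight L δ) :
    Real.log d ≤ finrank ℝ V * Real.log (2 / δ) := by
  rw [← Real.log_pow]
  exact Real.log_le_log (mod_cast hL.pos) (A.natCast_le_pow_finrank hA hL hP)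

end LinearAutomaton

section Measurements

variable {Q C : Type*} [Fintype Q]

theorem normSq_nonneg (v : Q → ℂ) : 0 ≤ normSq v := sq_nonneg _

theorem trace_vecMulVec_star (v : Q → ℂ) : (Matrix.vecMulVec v (star v)).trace = normSq v := by
  rw [Matrix.trace_vecMulVec, normSq, EuclideanSpace.norm_sq_eq, dotProduct, Complex.ofReal_sum]
  exact Finset.sum_congr rfl fun i _ => by simp [Complex.mul_conj']

theorem mul_vecMulVec_star_mul (M : Matrix Q Q ℂ) (v : Q → ℂ) :
    M * Matrix.vecMulVec v (star v) * Mᴴ = Matrix.vecMulVec (M *ᵥ v) (star (M *ᵥ v)) := by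
  rw [Matrix.mul_vecMulVec, Matrix.vecMulVec_mul, Matrix.star_mulVec]

variable [DecidableEq Q]

theorem normSq_ket (q : Q) : normSq (ket q) = 1 := by
  simp [normSq, ket]

namespace GeneralMeasurement

variable [Fintype C]

theorem sum_trace_mul_mul_conjTranspose (μ : GeneralMeasurement Q C) (ρ : Matrix Q Q ℂ) :
    ∑ c, (μ.op c * ρ * (μ.op c)ᴴ).trace = ρ.trace := by
  have h (c : C) : (μ.op c * ρ * (μ.op c)ᴴ).trace = ((μ.op c)ᴴ * μ.op c * ρ).trace :=
    Matrix.trace_mul_cycle _ _ _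
  simp only [h]
  rw [← Matrix.trace_sum, ← Finset.sum_mul, μ.complete, one_mul]

theorem sum_normSq_op_mulVec (μ : GeneralMeasurement Q C) (v : Q → ℂ) :
    ∑ c, normSq (μ.op c *ᵥ v) = normSq v := by
  have h := μ.sum_trace_mul_mul_conjTranspose (Matrix.vecMulVec v (star v))
  simp only [mul_vecMulVec_star_mul, trace_vecMulVec_star] at h
  exact_mod_cast h

theorem normSq_op_mulVec_le (μ : GeneralMeasurement Q C) (c : C) (v : Q → ℂ) :
    normSq (μ.op c *ᵥ v) ≤ normSq v := by
  rw [← μ.sum_normSq_op_mulVec v]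
  exact Finset.single_le_sum (f := fun c => normSq (μ.op c *ᵥ v))
    (fun _ _ => normSq_nonneg _) (Finset.mem_univ c)

/-- The measurement that applies the unitary `U` first and then measures with `μ`. -/
def afterUnitary (μ : GeneralMeasurement Q C) (U : Matrix.unitaryGroup Q ℂ) :
    GeneralMeasurement Q C where
  op c := μ.op c * U
  complete := by
    have h (c : C) : (μ.op c * (U : Matrix Q Q ℂ))ᴴ * (μ.op c * U) =
        (U : Matrix Q Q ℂ)ᴴ * ((μ.op c)ᴴ * μ.op c) * U := by
      simp only [Matrix.conjTranspose_mul, Matrix.mul_assoc]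
    simp only [h, ← Finset.sum_mul, ← Finset.mul_sum, μ.complete, mul_one]
    exact Unitary.coe_star_mul_self U

/-- The measurement with a single outcome, which leaves every state unchanged. -/
def trivial (Q : Type*) [Fintype Q] [DecidableEq Q] : GeneralMeasurement Q Unit where
  op _ := 1
  complete := by simp

open Classical in
/-- The measurement whose outcome is the truth value of `p` in every state. -/
noncomputable def ofProp (Q : Type*) [Fintype Q] [DecidableEq Q] (p : Prop) :
    GeneralMeasurement Q Bool where
  op b := if b = decide p then 1 else 0
  complete := by simp

open Classical in
theorem normSq_ofProp_true (p : Prop) (v : Q → ℂ) :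
    normSq ((ofProp Q p).op true *ᵥ v) = if p then normSq v else 0 := by
  by_cases hp : p <;> simp [ofProp, hp, normSq]

end GeneralMeasurement

/-- A projective measurement, seen as a general one with the projectors as operators. -/
def ProjectiveMeasurement.toGeneralMeasurement [Fintype C] (μ : ProjectiveMeasurement Q C) :
    GeneralMeasurement Q C where
  op := μ.proj
  complete := by
    rw [← μ.complete]
    refine Finset.sum_congr rfl fun c _ => ?_
    rw [← Matrix.star_eq_conjTranspose, (μ.isProj c).isSelfAdjoint.star_eq,
      (μ.isProj c).isIdempotentElem.eq]

end Measurements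

theorem sum_zip_ofFn_cons {α C β : Type*} [Fintype C] [AddCommMonoid β] (a : α)
    (x : List α) (F : List (α × C) → β) :
    ∑ y : Fin (a :: x).length → C, F ((a :: x).zip (List.ofFn y)) =
      ∑ c, ∑ y : Fin x.length → C, F ((a, c) :: x.zip (List.ofFn y)) := by
  rw [← Fintype.sum_prod_type']
  refine (Fintype.sum_equiv (Fin.consEquiv fun _ : Fin (x.length + 1) => C) _ _ fun p => ?_).symm
  simp [Fin.consEquiv, List.ofFn_succ]

section PureState

variable {Q S : Type*} [DecidableEq S]

/-- The family of density matrices `|v⟩⟨v|` in the classical state `s` and `0` elsewhere, which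
stands for being in the classical state `s` and the quantum state `v`. -/
def pureState (s : S) (v : Q → ℂ) : S → Matrix Q Q ℂ :=
  Pi.single s (Matrix.vecMulVec v (star v))

theorem sum_map_pureState [Fintype S] {V : Type*} [AddCommMonoid V] [Module ℝ V]
    (T : S → Matrix Q Q ℂ →ₗ[ℝ] V) (s : S) (v : Q → ℂ) :
    ∑ t, T t (pureState s v t) = T s (Matrix.vecMulVec v (star v)) := by
  rw [Fintype.sum_eq_single s fun t ht => by rw [pureState, Pi.single_eq_of_ne ht, map_zero],
    pureState, Pi.single_eq_same]

end PureState

/-- A common generalization of the three kinds of semi-quantum automata: a 1QCFA that decides at the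
end of the word by the measurement `final s` of its classical state `s`, with `true` for acceptance.
The initial states are `start` (quantum) and `cstart` (classical). -/
structure SemiQuantumAutomaton (α Q S C : Type*) [Fintype Q] [DecidableEq Q] [Fintype C] where
  start : Q
  cstart : S
  meas : S → α → GeneralMeasurement Q C
  step : S → α → C → S
  final : S → GeneralMeasurement Q Bool

namespace SemiQuantumAutomaton

variable {α Q S C : Type*} [Fintype Q] [DecidableEq Q] [Fintype C]
  (A : SemiQuantumAutomaton α Q S C)

/-- The probability of accepting a word read from the classical state `s` and the vector `v`,
multiplied by `normSq v` when `v` is not a unit vector. -/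
noncomputable def acceptProbFrom : List α → S → (Q → ℂ) → ℝ
  | [], s, v => normSq ((A.final s).op true *ᵥ v)
  | a :: x, s, v => ∑ c, acceptProbFrom x (A.step s a c) ((A.meas s a).op c *ᵥ v)

/-- The probability of accepting a word. -/
noncomputable def acceptProb (x : List α) : ℝ := A.acceptProbFrom x A.cstart (ket A.start)

/-- The classical state and the unnormalized quantum state reached from `p` by reading the letters
of `w` with the outcomes of `w`. -/
def run (w : List (α × C)) (p : S × (Q → ℂ)) : S × (Q → ℂ) :=
  w.foldl (fun p e => (A.step p.1 e.1 e.2, (A.meas p.1 e.1).op e.2 *ᵥ p.2)) p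

theorem acceptProbFrom_nonneg (x : List α) (s : S) (v : Q → ℂ) : 0 ≤ A.acceptProbFrom x s v := by
  induction x generalizing s v with
  | nil => exact normSq_nonneg _
  | cons a x ih => exact Finset.sum_nonneg fun c _ => ih _ _

theorem acceptProbFrom_le_normSq (x : List α) (s : S) (v : Q → ℂ) :
    A.acceptProbFrom x s v ≤ normSq v := by
  induction x generalizing s v with
  | nil => exact (A.final s).normSq_op_mulVec_le true v
  | cons a x ih =>
    rw [← (A.meas s a).sum_normSq_op_mulVec v]
    exact Finset.sum_le_sum fun c _ => ih _ _

theorem abs_acceptProb_le_one (x : List α) : |A.acceptProb x| ≤ 1 := by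
  rw [acceptProb, abs_of_nonneg (A.acceptProbFrom_nonneg ..)]
  exact (A.acceptProbFrom_le_normSq ..).trans_eq (normSq_ket _)

theorem acceptProbFrom_eq_sum_run (x : List α) (s : S) (v : Q → ℂ) :
    A.acceptProbFrom x s v = ∑ y : Fin x.length → C,
      normSq ((A.final (A.run (x.zip (List.ofFn y)) (s, v)).1).op true *ᵥ
        (A.run (x.zip (List.ofFn y)) (s, v)).2) := by
  induction x generalizing s v with
  | nil => simp [acceptProbFrom, run]
  | cons a x ih =>
    rw [acceptProbFrom, sum_zip_ofFn_cons a x fun w =>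
      normSq ((A.final (A.run w (s, v)).1).op true *ᵥ (A.run w (s, v)).2)]
    exact Finset.sum_congr rfl fun c _ => ih _ _

section Linearization

variable [Fintype S] [DecidableEq S]

/-- The linear automaton of a semi-quantum automaton. Its vectors are the families of matrices
indexed by the classical states: probabilities are quadratic in a vector `v` but linear in the
density matrix `|v⟩⟨v|`. -/
noncomputable def toLinearAutomaton : LinearAutomaton ℝ α (S → Matrix Q Q ℂ) where
  start := pureState A.cstart (ket A.start)
  step a := ∑ s, ∑ c, LinearMap.single ℝ (fun _ => Matrix Q Q ℂ) (A.step s a c) ∘ₗ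
    LinearMap.mulLeftRight ℝ ((A.meas s a).op c, ((A.meas s a).op c)ᴴ) ∘ₗ LinearMap.proj s
  final := ∑ s, Complex.reLm ∘ₗ Matrix.traceLinearMap Q ℝ ℂ ∘ₗ
    LinearMap.mulLeftRight ℝ ((A.final s).op true, ((A.final s).op true)ᴴ) ∘ₗ LinearMap.proj s

theorem toLinearAutomaton_step_pureState (a : α) (s : S) (v : Q → ℂ) :
    A.toLinearAutomaton.step a (pureState s v) =
      ∑ c, pureState (A.step s a c) ((A.meas s a).op c *ᵥ v) := by
  have h := sum_map_pureState (fun s => ∑ c,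
    LinearMap.single ℝ (fun _ => Matrix Q Q ℂ) (A.step s a c) ∘ₗ
      LinearMap.mulLeftRight ℝ ((A.meas s a).op c, ((A.meas s a).op c)ᴴ)) s v
  simpa [toLinearAutomaton, mul_vecMulVec_star_mul, pureState] using h

theorem toLinearAutomaton_final_pureState (s : S) (v : Q → ℂ) :
    A.toLinearAutomaton.final (pureState s v) = normSq ((A.final s).op true *ᵥ v) := by
  have h := sum_map_pureState (fun s => Complex.reLm ∘ₗ Matrix.traceLinearMap Q ℝ ℂ ∘ₗ
    LinearMap.mulLeftRight ℝ ((A.final s).op true, ((A.final s).op true)ᴴ)) s v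
  simpa [toLinearAutomaton, mul_vecMulVec_star_mul, trace_vecMulVec_star,
    -Matrix.trace_vecMulVec] using h

theorem weightFrom_pureState (x : List α) (s : S) (v : Q → ℂ) :
    A.toLinearAutomaton.weightFrom x (pureState s v) = A.acceptProbFrom x s v := by
  induction x generalizing s v with
  | nil => exact A.toLinearAutomaton_final_pureState s v
  | cons a x ih =>
    rw [LinearAutomaton.weightFrom, LinearMap.comp_apply, toLinearAutomaton_step_pureState,
      map_sum, acceptProbFrom]
    exact Finset.sum_congr rfl fun c _ => ih _ _

theorem weight_toLinearAutomaton : A.toLinearAutomaton.weight = A.acceptProb :=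
  funext fun x => A.weightFrom_pureState x A.cstart (ket A.start)

end Linearization

theorem log_div_le_sq_card_mul_card [Fintype S] {L : Language α} {d : ℕ}
    (hL : HasMinimalDFASize L d) {δ : ℝ} (hP : RecognizesIsolated A.acceptProb L δ) :
    Real.log d / (2 * Real.log (2 / δ)) ≤ (Fintype.card Q : ℝ) ^ 2 * Fintype.card S := by
  classical
  have hlog : 0 < Real.log (2 / δ) := Real.log_pos hP.one_lt_two_div
  have hdim : finrank ℝ (S → Matrix Q Q ℂ) = Fintype.card S * (Fintype.card Q ^ 2 * 2) := by
    simp [finrank_pi_fintype, finrank_matrix, sq]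
  rw [← weight_toLinearAutomaton] at hP
  have hle := A.toLinearAutomaton.log_le_finrank_mul
    (by rw [weight_toLinearAutomaton]; exact A.abs_acceptProb_le_one) hL hP
  rw [hdim] at hle
  push_cast at hle
  rw [div_le_iff₀ (by positivity)]
  linarith

end SemiQuantumAutomaton

section Automata

variable {α Q S C : Type*} [Fintype Q] [DecidableEq Q]

/-- A 1QCFA as a semi-quantum automaton; acceptance depends on the classical state only. -/
noncomputable def QCFA.toSemiQuantumAutomaton [Fintype C] (A : QCFA α Q S C) :
    SemiQuantumAutomaton α Q S C where
  start := A.start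
  cstart := A.cstart
  meas := A.meas
  step := A.step
  final s := .ofProp Q (s ∈ A.accept)

theorem QCFA.acceptProb_toSemiQuantumAutomaton [Fintype C] (A : QCFA α Q S C) :
    A.toSemiQuantumAutomaton.acceptProb = A.acceptProb := by
  funext x
  rw [SemiQuantumAutomaton.acceptProb, SemiQuantumAutomaton.acceptProbFrom_eq_sum_run]
  exact Finset.sum_congr rfl fun c _ => GeneralMeasurement.normSq_ofProp_true _ _

/-- A 1QFAC as a semi-quantum automaton; a unitary is a measurement with a single outcome. -/
def QFAC.toSemiQuantumAutomaton (A : QFAC α Q S) : SemiQuantumAutomaton α Q S Unit where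
  start := A.start
  cstart := A.cstart
  meas s a := (GeneralMeasurement.trivial Q).afterUnitary (A.U s a)
  step s a _ := A.step s a
  final s := (A.meas s).toGeneralMeasurement

theorem QFAC.acceptProb_toSemiQuantumAutomaton (A : QFAC α Q S) :
    A.toSemiQuantumAutomaton.acceptProb = A.acceptProb := by
  funext x
  suffices h : ∀ p : S × (Q → ℂ), A.toSemiQuantumAutomaton.acceptProbFrom x p.1 p.2 =
      let r := x.foldl (fun p a => (A.step p.1 a, (A.U p.1 a : Matrix Q Q ℂ) *ᵥ p.2)) p
      normSq ((A.meas r.1).proj true *ᵥ r.2) from h (A.cstart, ket A.start)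
  induction x with
  | nil => exact fun _ => rfl
  | cons a x ih =>
    intro p
    have hU : (A.toSemiQuantumAutomaton.meas p.1 a).op () = A.U p.1 a := one_mul _
    rw [SemiQuantumAutomaton.acceptProbFrom, Fintype.sum_unique, List.foldl_cons, ← ih]
    exact congrArg (fun M => A.toSemiQuantumAutomaton.acceptProbFrom x _ (M *ᵥ p.2)) hU

/-- A CL-1QFA as a semi-quantum automaton: a deterministic automaton `M` for the control language
reads the measurement outcomes. -/
noncomputable def CL1QFA.toSemiQuantumAutomaton [Fintype C] (A : CL1QFA α Q C) (M : DFA C S) :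
    SemiQuantumAutomaton α Q S C where
  start := A.start
  cstart := M.start
  meas _ a := A.meas.toGeneralMeasurement.afterUnitary (A.U a)
  step s _ c := M.step s c
  final s := .ofProp Q (s ∈ M.accept)

theorem CL1QFA.run_toSemiQuantumAutomaton [Fintype C] (A : CL1QFA α Q C) (M : DFA C S)
    (w : List (α × C)) (s : S) (v : Q → ℂ) :
    (A.toSemiQuantumAutomaton M).run w (s, v) = (M.evalFrom s (w.map Prod.snd),
      w.foldl (fun v p => A.meas.proj p.2 *ᵥ ((A.U p.1 : Matrix Q Q ℂ) *ᵥ v)) v) := by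
  induction w generalizing s v with
  | nil => rfl
  | cons e w ih =>
    rw [List.map_cons, DFA.evalFrom_cons, List.foldl_cons, ← ih, Matrix.mulVec_mulVec]
    rfl

theorem CL1QFA.acceptProb_toSemiQuantumAutomaton [Fintype C] (A : CL1QFA α Q C) {M : DFA C S}
    (hM : M.accepts = A.control) : (A.toSemiQuantumAutomaton M).acceptProb = A.acceptProb := by
  funext x
  rw [SemiQuantumAutomaton.acceptProb, SemiQuantumAutomaton.acceptProbFrom_eq_sum_run,
    CL1QFA.acceptProb, ← hM]
  refine Finset.sum_congr rfl fun y _ => ?_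
  rw [A.run_toSemiQuantumAutomaton, List.map_snd_zip (by simp)]
  exact GeneralMeasurement.normSq_ofProp_true _ _

end Automata

theorem rpow_le_mul_of_le_sq_mul {t e : ℝ} (ht : 0 ≤ t) (he : 0 < e) (he' : e ≤ 1 / 2) {q k : ℕ}
    (h : t ≤ (q : ℝ) ^ 2 * k) : t ^ e ≤ (q : ℝ) * k := by
  obtain hqk | hqk := Nat.eq_zero_or_pos (q * k)
  · have ht0 : t = 0 := by
      obtain rfl | rfl := Nat.mul_eq_zero.1 hqk <;> exact le_antisymm (by simpa using h) ht
    rw [ht0, Real.zero_rpow he.ne']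
    positivity
  · have hle : t ≤ ((q : ℝ) * k) ^ 2 := by
      refine h.trans ?_
      rw [mul_pow]
      gcongr
      exact_mod_cast Nat.le_self_pow two_ne_zero k
    calc
      t ^ e ≤ (((q : ℝ) * k) ^ 2) ^ e := Real.rpow_le_rpow ht hle he.le
      _ = ((q : ℝ) * k) ^ (2 * e) := by
        rw [← Real.rpow_natCast_mul (by positivity), Nat.cast_ofNat]
      _ ≤ (q : ℝ) * k :=
        Real.rpow_le_self_of_one_le (mod_cast hqk) (by linarith)

theorem RecognizesIsolated.rpow_four_ninths_le {α : Type*} {L : Language α} {P : List α → ℝ}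
    {δ : ℝ} (hP : RecognizesIsolated P L δ) {d q k : ℕ}
    (h : Real.log d / (2 * Real.log (2 / δ)) ≤ (q : ℝ) ^ 2 * k) :
    (Real.log d / (2 * Real.log (2 / δ))) ^ (4 / 9 : ℝ) ≤ (q : ℝ) * k :=
  have hlog : 0 < Real.log (2 / δ) := Real.log_pos hP.one_lt_two_div
  rpow_le_mul_of_le_sq_mul (div_nonneg (Real.log_natCast_nonneg d) (by positivity))
    (by norm_num) (by norm_num) h

end SemiQuantum

theorem theorem4_general {α : Type*} (L : Language α) (d : ℕ)
    (hL : SemiQuantum.HasMinimalDFASize L d) (δ : ℝ) :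
    (∀ (Q C : Type*) [Fintype Q] [DecidableEq Q] [Fintype C]
        (A : SemiQuantum.CL1QFA α Q C) (k : ℕ),
      SemiQuantum.HasMinimalDFASize A.control k →
      SemiQuantum.RecognizesIsolated A.acceptProb L δ →
      Real.log d / (2 * Real.log (2 / δ)) ≤ (Fintype.card Q : ℝ) ^ 2 * k) ∧
    (∀ (Q S : Type*) [Fintype Q] [DecidableEq Q] [Fintype S]
        (A : SemiQuantum.QFAC α Q S),
      SemiQuantum.RecognizesIsolated A.acceptProb L δ →
      Real.log d / (2 * Real.log (2 / δ)) ≤ (Fintype.card Q : ℝ) ^ 2 * Fintype.card S) ∧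
    (∀ (Q S C : Type*) [Fintype Q] [DecidableEq Q] [Fintype S] [Fintype C]
        (A : SemiQuantum.QCFA α Q S C),
      SemiQuantum.RecognizesIsolated A.acceptProb L δ →
      Real.log d / (2 * Real.log (2 / δ)) ≤ (Fintype.card Q : ℝ) ^ 2 * Fintype.card S) := by
  refine ⟨fun Q C _ _ _ A k hk hP => ?_, fun Q S _ _ _ A hP => ?_, fun Q S C _ _ _ _ A hP => ?_⟩
  · obtain ⟨M, hM⟩ := hk.1
    rw [← A.acceptProb_toSemiQuantumAutomaton hM] at hP
    simpa only [Fintype.card_fin] using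
      (A.toSemiQuantumAutomaton M).log_div_le_sq_card_mul_card hL hP
  · rw [← A.acceptProb_toSemiQuantumAutomaton] at hP
    exact A.toSemiQuantumAutomaton.log_div_le_sq_card_mul_card hL hP
  · rw [← A.acceptProb_toSemiQuantumAutomaton] at hP
    exact A.toSemiQuantumAutomaton.log_div_le_sq_card_mul_card hL hP

theorem theorem4 {α : Type*} [Finite α] (L : Language α) (d : ℕ)
    (hL : SemiQuantum.HasMinimalDFASize L d) (δ : ℝ) :
    -- CL-1QFA; the classical states are those of the minimal DFA of the control language
    (∀ (Q C : Type*) [Fintype Q] [DecidableEq Q] [Fintype C]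
        (A : SemiQuantum.CL1QFA α Q C) (k : ℕ),
      SemiQuantum.HasMinimalDFASize A.control k →
      SemiQuantum.RecognizesIsolated A.acceptProb L δ →
      (Real.log d / (2 * Real.log (2 / δ))) ^ (4 / 9 : ℝ) ≤ (Fintype.card Q : ℝ) * (k : ℝ)) ∧
    -- 1QFAC
    (∀ (Q S : Type*) [Fintype Q] [DecidableEq Q] [Fintype S]
        (A : SemiQuantum.QFAC α Q S),
      SemiQuantum.RecognizesIsolated A.acceptProb L δ →
      (Real.log d / (2 * Real.log (2 / δ))) ^ (4 / 9 : ℝ) ≤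
        (Fintype.card Q : ℝ) * (Fintype.card S : ℝ)) ∧
    -- 1QCFA
    (∀ (Q S C : Type*) [Fintype Q] [DecidableEq Q] [Fintype S] [Fintype C]
        (A : SemiQuantum.QCFA α Q S C),
      SemiQuantum.RecognizesIsolated A.acceptProb L δ →
      (Real.log d / (2 * Real.log (2 / δ))) ^ (4 / 9 : ℝ) ≤
        (Fintype.card Q : ℝ) * (Fintype.card S : ℝ)) :=
  (theorem4_general L d hL δ).imp
    (fun h Q C _ _ _ A k hk hP => hP.rpow_four_ninths_le (h Q C A k hk hP)) <| .imp
    (fun h Q S _ _ _ A hP => hP.rpow_four_ninths_le (h Q S A hP))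
    (fun h Q S C _ _ _ _ A hP => hP.rpow_four_ninths_le (h Q S C A hP))
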